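/- Let $\Omega\subset\mathbb R^2$ be a bounded domain whose boundary $\Gamma=\partial\Omega$ is a simple closed polygon, and let $\mathrm{d}x$ denote arc length on $\Gamma$. For $u\in L^2(\Gamma)$ (real-valued) put \[ |u|_b=\left(\int_\Gamma\int_\Gamma\frac{(u(x)-u(y))^2}{|x-y|^2}\,\mathrm{d}x\,\mathrm{d}y\right)^{1/2},\qquad \|u\|_b=\left(\|u\|_{L^2(\Gamma)}^2+|u|_b^2\right)^{1/2}, \] and let $H^{1/2}(\Gamma)=\{u\in L^2(\Gamma): |u|_b<\infty\}$. Then there exists a constant $C_\Gamma>0$, depending only on $\Gamma$, such that \[ \inf_{c\in\mathbb R}\|u-c\|_b\le C_\Gamma\,|u|_b\qquad\text{for all } u\in H^{1/2}(\Gamma). \] -/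

import Mathlib

open MeasureTheory Set
open scoped ENNReal

/-- The Euclidean plane `ℝ²`. -/
abbrev Plane : Type := EuclideanSpace ℝ (Fin 2)

/-- A simple closed polygon: at least three vertices, nondegenerate sides, two consecutive sides
meet exactly in their common vertex, and non-consecutive sides are disjoint.
Side `i` joins vertex `i` to vertex `finRotate m i`, the next one in cyclic order. -/
structure Polygon.IsSimpleClosed {m : ℕ} (P : Polygon Plane m) : Prop where
  three_le : 3 ≤ m
  nondegenerate : P.HasNondegenerateEdges
  consecutive : ∀ i : Fin m,
    P.edgeSet ℝ i ∩ P.edgeSet ℝ (finRotate m i) = {P (finRotate m i)}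
  disjoint : ∀ i j : Fin m, i ≠ j → j ≠ finRotate m i → i ≠ finRotate m j →
    Disjoint (P.edgeSet ℝ i) (P.edgeSet ℝ j)

/-- A (bounded) polygonal domain of the plane: a bounded nonempty connected open set whose
topological boundary is a simple closed polygon. -/
structure IsPolygonalDomain (Ω : Set Plane) : Prop where
  isOpen : IsOpen Ω
  isConnected : IsConnected Ω
  isBounded : Bornology.IsBounded Ω
  boundary : ∃ (m : ℕ) (P : Polygon Plane m), P.IsSimpleClosed ∧ frontier Ω = P.boundary ℝ

noncomputable section

/-- Arc length on a curve `Γ`: the one-dimensional Hausdorff measure restricted to `Γ`. -/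
def arcLength (Γ : Set Plane) : Measure Plane :=
  (Measure.hausdorffMeasure 1 : Measure Plane).restrict Γ

/-- The Sobolev–Slobodetskii seminorm
`|u|_b = (∫_Γ ∫_Γ (u x - u y)² / |x - y|² dx dy)^{1/2}`, with value `∞` when the integral
diverges. -/
def slobSeminorm (Γ : Set Plane) (u : Plane → ℝ) : ℝ≥0∞ :=
  (∫⁻ x, ∫⁻ y, ENNReal.ofReal ((u x - u y) ^ 2 / ‖x - y‖ ^ 2)
    ∂(arcLength Γ) ∂(arcLength Γ)) ^ (1 / 2 : ℝ)

/-- The Sobolev–Slobodetskii norm `‖u‖_b = (‖u‖²_{L²(Γ)} + |u|_b²)^{1/2}`. -/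
def slobNorm (Γ : Set Plane) (u : Plane → ℝ) : ℝ≥0∞ :=
  (eLpNorm u 2 (arcLength Γ) ^ 2 + slobSeminorm Γ u ^ 2) ^ (1 / 2 : ℝ)

/-- `u ∈ H^{1/2}(Γ)`: `u` is (a representative of an element) in `L²(Γ)` and its
Sobolev–Slobodetskii seminorm is finite. Only the values of `u` on `Γ` matter. -/
def MemHHalf (Γ : Set Plane) (u : Plane → ℝ) : Prop :=
  MemLp u 2 (arcLength Γ) ∧ slobSeminorm Γ u < ∞

end

/-! Subtracting a constant leaves the seminorm unchanged, so only the L² term needs a bound. Since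
|x - y| ≤ diam Γ, the double integral of (u x - u y)² is at most diam(Γ)² |u|_b². Averaging over x
yields a point z with ‖u - u z‖² ≤ (diam(Γ)² / length Γ) |u|_b², and c = u z works. The polygon
enters only through its finite length. -/

/-- The boundary of a polygon in the plane has finite length. -/
theorem hausdorffMeasure_polygon_boundary_lt_top {m : ℕ} (P : Polygon Plane m) :
    (Measure.hausdorffMeasure 1 : Measure Plane) (P.boundary ℝ) < ∞ := by
  unfold Polygon.boundary
  refine (measure_iUnion_le _).trans_lt ?_
  rw [tsum_fintype]
  refine ENNReal.sum_lt_top.2 fun i _ => ?_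
  unfold Polygon.edgeSet
  rw [hausdorffMeasure_affineSegment]
  exact edist_lt_top _ _

/-- Subtracting a constant does not change the Slobodetskii seminorm. -/
theorem slobSeminorm_sub_const (Γ : Set Plane) (u : Plane → ℝ) (c : ℝ) :
    slobSeminorm Γ (fun x => u x - c) = slobSeminorm Γ u := by
  simp only [slobSeminorm, sub_sub_sub_cancel_right]

theorem slobSeminorm_sq (Γ : Set Plane) (u : Plane → ℝ) :
    slobSeminorm Γ u ^ 2 =
      ∫⁻ x, ∫⁻ y, ENNReal.ofReal ((u x - u y) ^ 2 / ‖x - y‖ ^ 2)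
        ∂(arcLength Γ) ∂(arcLength Γ) := by
  rw [slobSeminorm, ← ENNReal.rpow_natCast, ← ENNReal.rpow_mul]
  norm_num

theorem eLpNorm_two_sq {α : Type*} [MeasurableSpace α] (μ : Measure α) (f : α → ℝ) :
    eLpNorm f 2 μ ^ 2 = ∫⁻ x, ENNReal.ofReal (f x ^ 2) ∂μ := by
  have h := eLpNorm_nnreal_pow_eq_lintegral (f := f) (μ := μ) (p := 2) two_ne_zero
  simp only [NNReal.coe_ofNat, ENNReal.coe_ofNat, ENNReal.rpow_ofNat] at h
  rw [h]
  refine lintegral_congr fun x => ?_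
  rw [← ofReal_norm, ← ENNReal.ofReal_pow (norm_nonneg _), Real.norm_eq_abs, sq_abs]

/-- On a bounded measurable set the double integral of `(u x - u y)²` is controlled by the
Slobodetskii seminorm. -/
theorem lintegral_lintegral_sq_sub_le_slobSeminorm {Γ : Set Plane} (hΓ : MeasurableSet Γ)
    (hb : Bornology.IsBounded Γ) (u : Plane → ℝ) :
    ∫⁻ x, ∫⁻ y, ENNReal.ofReal ((u x - u y) ^ 2) ∂(arcLength Γ) ∂(arcLength Γ) ≤
      ENNReal.ofReal (Metric.diam Γ ^ 2) * slobSeminorm Γ u ^ 2 := by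
  have hmem : ∀ᵐ x ∂(arcLength Γ), x ∈ Γ := ae_restrict_mem hΓ
  rw [slobSeminorm_sq, ← lintegral_const_mul' _ _ ENNReal.ofReal_ne_top]
  refine lintegral_mono_ae ?_
  filter_upwards [hmem] with x hx
  rw [← lintegral_const_mul' _ _ ENNReal.ofReal_ne_top]
  refine lintegral_mono_ae ?_
  filter_upwards [hmem] with y hy
  rw [← ENNReal.ofReal_mul (sq_nonneg _)]
  refine ENNReal.ofReal_le_ofReal ?_
  rcases eq_or_ne x y with rfl | hxy
  · simp
  have hpos : 0 < ‖x - y‖ := norm_pos_iff.2 (sub_ne_zero.2 hxy)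
  have hle : ‖x - y‖ ≤ Metric.diam Γ := by
    rw [← dist_eq_norm]
    exact Metric.dist_le_diam_of_mem hb hx hy
  rw [← mul_div_assoc, le_div_iff₀ (by positivity), mul_comm]
  gcongr

/-- The Poincaré inequality for the Slobodetskii seminorm on a bounded measurable set of finite
length. -/
theorem exists_iInf_slobNorm_sub_const_le {Γ : Set Plane} (hΓ : MeasurableSet Γ)
    (hb : Bornology.IsBounded Γ) (hfin : arcLength Γ univ < ∞) :
    ∃ C : ℝ, 0 < C ∧ ∀ u : Plane → ℝ, MemHHalf Γ u →
      ⨅ c : ℝ, slobNorm Γ (fun x => u x - c) ≤ ENNReal.ofReal C * slobSeminorm Γ u := by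
  -- With zero length there is no average to take, but both sides vanish.
  rcases eq_or_ne (arcLength Γ) 0 with h0 | h0
  · refine ⟨1, one_pos, fun u _ => (iInf_le _ 0).trans ?_⟩
    simp [slobNorm, slobSeminorm, h0]
  have : IsFiniteMeasure (arcLength Γ) := ⟨hfin⟩
  have hne : arcLength Γ univ ≠ 0 := by simpa using h0
  set K : ℝ≥0∞ := ENNReal.ofReal (Metric.diam Γ ^ 2) / arcLength Γ univ with hK
  have hKtop : K ≠ ∞ := ENNReal.div_ne_top ENNReal.ofReal_ne_top hne
  -- `K` pays for the L² term, 1 for the seminorm term in the squared norm.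
  refine ⟨√(K.toReal + 1), by positivity, fun u hu => ?_⟩
  have hum : AEMeasurable u (arcLength Γ) := hu.1.1.aemeasurable
  have hmeas : AEMeasurable (fun x => ∫⁻ y, ENNReal.ofReal ((u x - u y) ^ 2) ∂(arcLength Γ))
      (arcLength Γ) :=
    AEMeasurable.lintegral_prod_right'
      (f := fun p : Plane × Plane => ENNReal.ofReal ((u p.1 - u p.2) ^ 2))
      ((hum.comp_fst.sub hum.comp_snd).pow_const 2).ennreal_ofReal
  -- The inner integral is at most its mean at some z; the value `u z` then serves as c in place of
  -- the mean of u.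
  obtain ⟨z, hz⟩ := exists_le_laverage h0 hmeas
  have hL2 : eLpNorm (fun x => u x - u z) 2 (arcLength Γ) ^ 2 ≤ K * slobSeminorm Γ u ^ 2 := by
    rw [eLpNorm_two_sq]
    simp_rw [sub_sq_comm (u _) (u z)]
    refine hz.trans ?_
    rw [laverage_eq, hK, ENNReal.mul_div_right_comm.symm]
    exact ENNReal.div_le_div_right (lintegral_lintegral_sq_sub_le_slobSeminorm hΓ hb u) _
  have hroot : ENNReal.ofReal √(K.toReal + 1) = (K + 1) ^ (1 / 2 : ℝ) := by
    rw [Real.sqrt_eq_rpow, ← ENNReal.ofReal_rpow_of_nonneg (by positivity) (by norm_num),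
      ENNReal.ofReal_add ENNReal.toReal_nonneg zero_le_one, ENNReal.ofReal_toReal hKtop,
      ENNReal.ofReal_one]
  refine (iInf_le _ (u z)).trans ?_
  calc slobNorm Γ (fun x => u x - u z)
      ≤ ((K + 1) * slobSeminorm Γ u ^ 2) ^ (1 / 2 : ℝ) := by
        rw [slobNorm, slobSeminorm_sub_const, add_mul, one_mul]
        gcongr
    _ = ENNReal.ofReal √(K.toReal + 1) * slobSeminorm Γ u := by
        rw [ENNReal.mul_rpow_of_nonneg _ _ (by norm_num), hroot, ← ENNReal.rpow_natCast,
          ← ENNReal.rpow_mul]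
        norm_num

theorem mainTheorem12 (Ω : Set Plane) (hΩ : IsPolygonalDomain Ω) :
    ∃ C : ℝ, 0 < C ∧ ∀ u : Plane → ℝ, MemHHalf (frontier Ω) u →
      ⨅ c : ℝ, slobNorm (frontier Ω) (fun x => u x - c) ≤
        ENNReal.ofReal C * slobSeminorm (frontier Ω) u := by
  obtain ⟨m, P, -, hP⟩ := hΩ.boundary
  refine exists_iInf_slobNorm_sub_const_le isClosed_frontier.measurableSet
    (hΩ.isBounded.closure.subset frontier_subset_closure) ?_
  rw [arcLength, Measure.restrict_apply_univ, hP]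
  exact hausdorffMeasure_polygon_boundary_lt_top P
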